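/- Let $H^2(\mathbb{D})$ be the (complex) Hardy space of analytic functions $f(z)=\sum_{n\ge 0}a_nz^n$ on the open unit disc $\mathbb{D}$ with $\sum_{n\ge 0}|a_n|^2<\infty$, with the inner product of the sequences of Taylor coefficients. Let $M_{2+z}$ be the bounded operator $f\mapsto(2+z)f$ on $H^2(\mathbb{D})$, let $M_{2+z}^*$ be its adjoint, and let $B$ be the unilateral backward shift $B\big(\sum_{n\ge 0}a_nz^n\big)=\sum_{n\ge 0}a_{n+1}z^n$. A bounded linear operator $T$ on a complex Banach space $X$ is called convex-cyclic if there is $x\in X$ such that the convex hull of the orbit $\{T^nx:n\ge 0\}$ is dense in $X$. It is called 1-weakly hypercyclic if there is $x\in X$ such that, for every nonzero continuous linear functional $f$ on $X$, the set $\{f(T^nx):n\ge 0\}$ is dense in $\mathbb{C}$. Then $M_{2+z}^*=2I+B$, the operator $M_{2+z}^*$ is convex-cyclic, and $M_{2+z}^*$ is not 1-weakly hypercyclic. -/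

import Mathlib

open Complex
open scoped Complex.UnitDisc InnerProductSpace

noncomputable section

/-- A bounded operator `T` is convex-cyclic if there is a vector `x` such that the convex hull of
its orbit `{x, T x, T² x, …}` is dense in norm. -/
def IsConvexCyclic {X : Type*} [NormedAddCommGroup X] [NormedSpace ℂ X] (T : X →L[ℂ] X) : Prop :=
  ∃ x : X, Dense (convexHull ℝ (Set.range fun n : ℕ => (T ^ n) x))

/-- A bounded operator `T` is 1-weakly hypercyclic if there is a vector `x` such that `f` maps the
orbit of `x` to a dense subset of `ℂ` for every nonzero continuous linear functional `f`. -/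
def IsOneWeaklyHypercyclic {X : Type*} [NormedAddCommGroup X] [NormedSpace ℂ X]
    (T : X →L[ℂ] X) : Prop :=
  ∃ x : X, ∀ f : X →L[ℂ] ℂ, f ≠ 0 → Dense (f '' Set.range fun n : ℕ => (T ^ n) x)

/-- The functions on the open unit disc given by a power series with square-summable
coefficients. -/
def hardySubmodule : Submodule ℂ (𝔻 → ℂ) where
  carrier := {f | ∃ a : lp (fun _ : ℕ => ℂ) 2,
    ∀ z : 𝔻, HasSum (fun n : ℕ => a n * (z : ℂ) ^ n) (f z)}
  zero_mem' := ⟨0, fun z => by simp⟩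
  add_mem' := by
    rintro f g ⟨a, ha⟩ ⟨b, hb⟩
    exact ⟨a + b, fun z => by simpa [add_mul] using (ha z).add (hb z)⟩
  smul_mem' := by
    rintro c f ⟨a, ha⟩
    exact ⟨c • a, fun z => by simpa [mul_assoc] using (ha z).mul_left c⟩

/-- The Hardy space `H²(𝔻)`: the space of analytic functions on the open unit disc with
square-summable Taylor coefficients. Its norm and inner product are those of the sequence of
Taylor coefficients, see below. (This is a separate type so that it does not carry the topology of
pointwise convergence.) -/
def HardySpace : Type := hardySubmodule

namespace HardySpace

instance : AddCommGroup HardySpace := inferInstanceAs (AddCommGroup hardySubmodule)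

instance : Module ℂ HardySpace := inferInstanceAs (Module ℂ hardySubmodule)

/-- The function on the disc underlying an element of the Hardy space, as a linear map. -/
def toFunₗ : HardySpace →ₗ[ℂ] 𝔻 → ℂ := hardySubmodule.subtype

lemma toFunₗ_injective : Function.Injective toFunₗ := Subtype.val_injective

/-- A power series that vanishes on the unit disc has zero coefficients. -/
lemma coeff_eq_zero {a : ℕ → ℂ}
    (h : ∀ z : 𝔻, HasSum (fun n : ℕ => a n * (z : ℂ) ^ n) 0) : a = 0 := by
  let p : FormalMultilinearSeries ℂ ℂ ℂ := FormalMultilinearSeries.ofScalars ℂ a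
  have hp : HasFPowerSeriesAt (fun _ : ℂ => (0 : ℂ)) p 0 := by
    rw [hasFPowerSeriesAt_iff]
    filter_upwards [Metric.ball_mem_nhds (0 : ℂ) one_pos] with z hz
    have := h (UnitDisc.mk z (by simpa using hz))
    simpa [p, FormalMultilinearSeries.coeff_ofScalars, mul_comm] using this
  have h0 := hp.eq_zero
  funext n
  have : p.coeff n = 0 := by rw [h0]; rfl
  simpa [p, FormalMultilinearSeries.coeff_ofScalars] using this

lemma coeff_unique {f : 𝔻 → ℂ} {a b : ℕ → ℂ}
    (ha : ∀ z : 𝔻, HasSum (fun n : ℕ => a n * (z : ℂ) ^ n) (f z))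
    (hb : ∀ z : 𝔻, HasSum (fun n : ℕ => b n * (z : ℂ) ^ n) (f z)) : a = b := by
  rw [← sub_eq_zero]
  refine coeff_eq_zero fun z => ?_
  simpa [sub_mul] using (ha z).sub (hb z)

/-- The sequence of Taylor coefficients of an element of the Hardy space. -/
def taylor (f : HardySpace) : lp (fun _ : ℕ => ℂ) 2 := Classical.choose f.2

lemma hasSum_taylor (f : HardySpace) (z : 𝔻) :
    HasSum (fun n : ℕ => taylor f n * (z : ℂ) ^ n) (toFunₗ f z) :=
  Classical.choose_spec f.2 z

lemma taylor_eq {f : HardySpace} {a : lp (fun _ : ℕ => ℂ) 2}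
    (h : ∀ z : 𝔻, HasSum (fun n : ℕ => a n * (z : ℂ) ^ n) (toFunₗ f z)) : taylor f = a :=
  Subtype.ext (coeff_unique (hasSum_taylor f) h)

lemma summable_coeff (a : lp (fun _ : ℕ => ℂ) 2) (z : 𝔻) :
    Summable fun n : ℕ => a n * (z : ℂ) ^ n := by
  refine Summable.of_norm_bounded (g := fun n => ‖a‖ * ‖(z : ℂ)‖ ^ n)
    ((summable_geometric_of_lt_one (norm_nonneg _) z.norm_lt_one).mul_left _) fun n => ?_
  rw [norm_mul, norm_pow]
  gcongr
  exact lp.norm_apply_le_norm (by norm_num) a n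

/-- The bijection between the Hardy space and `ℓ²` that sends a function to its Taylor
coefficients. -/
def taylorₗ : HardySpace ≃ₗ[ℂ] lp (fun _ : ℕ => ℂ) 2 where
  toFun := taylor
  map_add' f g := taylor_eq fun z => by
    simpa [add_mul] using (hasSum_taylor f z).add (hasSum_taylor g z)
  map_smul' c f := taylor_eq fun z => by
    simpa [mul_assoc] using (hasSum_taylor f z).mul_left c
  invFun a := ⟨fun z => ∑' n : ℕ, a n * (z : ℂ) ^ n, a, fun z => (summable_coeff a z).hasSum⟩
  left_inv f := Subtype.ext (funext fun z => (hasSum_taylor f z).tsum_eq)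
  right_inv a := taylor_eq fun z => (summable_coeff a z).hasSum

instance : NormedAddCommGroup HardySpace :=
  NormedAddCommGroup.induced HardySpace (lp (fun _ : ℕ => ℂ) 2) taylorₗ taylorₗ.injective

instance : InnerProductSpace ℂ HardySpace :=
  InnerProductSpace.induced taylorₗ

lemma inner_eq (f g : HardySpace) : ⟪f, g⟫_ℂ = ⟪taylor f, taylor g⟫_ℂ := rfl

/-- `taylorₗ` as an isometric isomorphism. -/
def taylorₗᵢ : HardySpace ≃ₗᵢ[ℂ] lp (fun _ : ℕ => ℂ) 2 where
  toLinearEquiv := taylorₗ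
  norm_map' _ := rfl

instance : CompleteSpace HardySpace :=
  taylorₗᵢ.toIsometryEquiv.completeSpace

lemma norm_toFunₗ_le (z : 𝔻) (f : HardySpace) : ‖toFunₗ f z‖ ≤ (1 - ‖(z : ℂ)‖)⁻¹ * ‖f‖ := by
  have hg := (hasSum_geometric_of_lt_one (norm_nonneg _) z.norm_lt_one).mul_right ‖f‖
  refine (hasSum_taylor f z).norm_le_of_bounded hg fun n => ?_
  rw [norm_mul, norm_pow, mul_comm]
  gcongr
  exact lp.norm_apply_le_norm (by norm_num) (taylor f) n

/-- The Hardy space is a reproducing kernel Hilbert space of functions on the disc. -/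
instance : RKHS ℂ HardySpace 𝔻 ℂ where
  coeCLM := ⟨toFunₗ, continuous_pi fun z =>
    (((LinearMap.proj z).comp toFunₗ).mkContinuous _ (norm_toFunₗ_le z)).continuous⟩
  coeCLM_injective := toFunₗ_injective

/-- A function `φ` on the disc is a multiplier of the Hardy space if `φ f` belongs to the Hardy
space for every `f` in it. -/
def IsMultiplier (φ : 𝔻 → ℂ) : Prop :=
  ∀ f : HardySpace, ∃ g : HardySpace, ∀ z : 𝔻, g z = φ z * f z

/-- The product `φ f` as an element of the Hardy space, for a multiplier `φ`. -/
def mulFun {φ : 𝔻 → ℂ} (hφ : IsMultiplier φ) (f : HardySpace) : HardySpace :=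
  Classical.choose (hφ f)

lemma mulFun_apply {φ : 𝔻 → ℂ} (hφ : IsMultiplier φ) (f : HardySpace) (z : 𝔻) :
    mulFun hφ f z = φ z * f z :=
  Classical.choose_spec (hφ f) z

/-- The multiplication operator `M_φ f = φ f`; it is bounded by the closed graph theorem. -/
def mulOp (φ : 𝔻 → ℂ) (hφ : IsMultiplier φ) : HardySpace →L[ℂ] HardySpace :=
  ContinuousLinearMap.ofSeqClosedGraph
    (g :=
      { toFun := mulFun hφ
        map_add' := fun f g => RKHS.ext fun z => by simp [mulFun_apply, mul_add]
        map_smul' := fun c f => RKHS.ext fun z => by simp [mulFun_apply, mul_left_comm] })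
    (by
      intro u x y hu hgu
      refine RKHS.ext fun z => ?_
      have h1 := ((RKHS.continuous_eval (H := HardySpace) z).tendsto y).comp hgu
      have h2 := (((RKHS.continuous_eval (H := HardySpace) z).tendsto x).comp hu).const_mul (φ z)
      refine tendsto_nhds_unique h1 ?_
      simpa [Function.comp_def, mulFun_apply] using h2)

lemma mulOp_apply (φ : 𝔻 → ℂ) (hφ : IsMultiplier φ) (f : HardySpace) (z : 𝔻) :
    mulOp φ hφ f z = φ z * f z :=
  mulFun_apply hφ f z

/-- If `(a₀, a₁, …)` is square-summable, then so is `(0, a₀, a₁, …)`. -/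
lemma memℓp_cons (a : lp (fun _ : ℕ => ℂ) 2) :
    Memℓp (E := fun _ : ℕ => ℂ) (fun n => Nat.casesOn n 0 fun k => a k) 2 := by
  have ha := lp.memℓp a
  rw [memℓp_gen_iff (by norm_num)] at ha ⊢
  rw [← summable_nat_add_iff 1]
  exact ha

lemma isMultiplier_two_add : IsMultiplier fun z => 2 + (z : ℂ) := by
  intro f
  let s : lp (fun _ : ℕ => ℂ) 2 := ⟨_, memℓp_cons (taylor f)⟩
  have hs (z : 𝔻) : HasSum (fun n : ℕ => s n * (z : ℂ) ^ n) (z * toFunₗ f z) := by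
    have h := (hasSum_taylor f z).mul_left (z : ℂ)
    have h0 : s 0 = 0 := rfl
    have hsucc (n : ℕ) : s (n + 1) = taylor f n := rfl
    rw [← hasSum_nat_add_iff' 1]
    simp only [hsucc, Finset.sum_range_one, h0, zero_mul, sub_zero]
    exact h.congr_fun fun n => by ring
  refine ⟨(⟨fun z => (2 + (z : ℂ)) * toFunₗ f z, (2 : ℂ) • taylor f + s, fun z => ?_⟩ :
    hardySubmodule), fun z => rfl⟩
  have h := ((hasSum_taylor f z).mul_left 2).add (hs z)
  rw [← add_mul] at h
  have hc (n : ℕ) : ((2 : ℂ) • taylor f + s) n = 2 * taylor f n + s n := rfl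
  simp only [hc, add_mul _ _ ((z : ℂ) ^ _), mul_assoc] at h ⊢
  exact h

/-- If `(a₀, a₁, …)` is square-summable, then so is `(a₁, a₂, …)`. -/
lemma memℓp_tail (a : lp (fun _ : ℕ => ℂ) 2) :
    Memℓp (E := fun _ : ℕ => ℂ) (fun n => a (n + 1)) 2 := by
  have ha := lp.memℓp a
  rw [memℓp_gen_iff (by norm_num)] at ha ⊢
  exact (summable_nat_add_iff 1).2 ha

/-- The backward shift `(a₀, a₁, a₂, …) ↦ (a₁, a₂, …)` on `ℓ²`. -/
def tailOp : lp (fun _ : ℕ => ℂ) 2 →L[ℂ] lp (fun _ : ℕ => ℂ) 2 :=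
  LinearMap.mkContinuous
    { toFun := fun a => ⟨fun n => a (n + 1), memℓp_tail a⟩
      map_add' := fun _ _ => rfl
      map_smul' := fun _ _ => rfl } 1 (by
    intro a
    rw [one_mul]
    have ha := (memℓp_gen_iff (by norm_num)).1 (lp.memℓp a)
    refine lp.norm_le_of_tsum_le (by norm_num) (norm_nonneg _) ?_
    rw [lp.norm_rpow_eq_tsum (by norm_num)]
    rw [ha.tsum_eq_zero_add]
    exact le_add_of_nonneg_left (by positivity))

/-- The unilateral backward shift `B` on the Hardy space: it sends the function with Taylor
coefficients `(a₀, a₁, a₂, …)` to the one with Taylor coefficients `(a₁, a₂, …)`. -/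
def backwardShift : HardySpace →L[ℂ] HardySpace :=
  (taylorₗᵢ.symm.toContinuousLinearEquiv : _ →L[ℂ] HardySpace) ∘L tailOp ∘L
    (taylorₗᵢ.toContinuousLinearEquiv : HardySpace →L[ℂ] _)

lemma taylor_backwardShift (f : HardySpace) (n : ℕ) :
    taylor (backwardShift f) n = taylor f (n + 1) :=
  congrArg (fun a : lp (fun _ : ℕ => ℂ) 2 => a n)
    (taylorₗᵢ.apply_symm_apply (tailOp (taylorₗᵢ f)))

end HardySpace

end

/-! ### Convex-cyclicity from eigenvectors on a ray -/

section ConvexCyclic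

variable {X : Type*} [NormedAddCommGroup X] [NormedSpace ℂ X]

/-! Write `T = 2 + B`; comparing Taylor coefficients identifies it with the adjoint.

Convex-cyclic: the geometric sequence of ratio `a` is an eigenvector with eigenvalue `2 + a`. Choose
eigenvalues `r k * w` with `w = exp (π I / 8)` and `r k` decreasing to `2`; by the identity theorem
their eigenvectors are total. Let `x` be a weighted sum of them. For `f ≠ 0`, `f (T ^ n x)` is a sum
of exponentials dominated by its first nonzero term, and the powers of `w` turn that term to
positive real part for infinitely many `n`. So `Re f` is unbounded above on the orbit, and
Hahn-Banach applies (`isConvexCyclic_of_eigenvectors`).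

Not 1-weakly hypercyclic: as `B` is a contraction and `1 + B` is injective, `‖T ^ n x‖` grows at
least like `n ^ 2` for every `x ≠ 0` (`norm_sq_pow_ge`). The inverse norms are then summable, and
Bang's lemma (`exists_one_le_norm_inner`) gives a functional whose values on the orbit all avoid the
open unit disc. -/

/-- The Hahn-Banach criterion for the density of a convex hull. -/
lemma dense_convexHull_of_not_bddAbove {s : Set X} (hs : s.Nonempty)
    (h : ∀ f : X →L[ℂ] ℂ, f ≠ 0 → ¬ BddAbove ((fun x => (f x).re) '' s)) :
    Dense (convexHull ℝ s) := by
  intro y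
  by_contra hy
  obtain ⟨f, u, hu, huy⟩ := RCLike.geometric_hahn_banach_closed_point (𝕜 := ℂ)
    (convex_convexHull ℝ s).closure isClosed_closure hy
  refine h f ?_ ⟨u, ?_⟩
  · rintro rfl
    obtain ⟨x, hx⟩ := hs
    have := hu x (subset_closure (subset_convexHull ℝ s hx))
    simp at this huy
    linarith
  · rintro _ ⟨x, hx, rfl⟩
    exact (hu x (subset_closure (subset_convexHull ℝ s hx))).le

/-- For `j = 0, 1, 2, 3` the real parts are `Re c`, `-Im c`, `-Re c`, `Im c`. -/
lemma exists_re_mul_I_pow_pos {c : ℂ} (hc : c ≠ 0) : ∃ j : ℕ, 0 < (c * I ^ j).re := by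
  by_contra! h
  have h0 := h 0
  have h1 := h 1
  have h2 := h 2
  have h3 := h 3
  simp [pow_succ] at h0 h1 h2 h3
  exact hc (Complex.ext (by simp; linarith) (by simp; linarith))

/-- A sum of exponentials whose bases lie on the ray through `w`, with `w ^ 4 = I`, has real parts
that are unbounded above. -/
lemma not_bddAbove_re_tsum {w : ℂ} (hw : w ^ 4 = I) {r : ℕ → ℝ} (hr : StrictAnti r)
    (hr1 : ∀ k, 1 < r k) {c : ℕ → ℂ} (hc : Summable fun k => ‖c k‖) (hc0 : c ≠ 0) :
    ¬ BddAbove (Set.range fun n : ℕ => (∑' k, c k * ((r k : ℂ) * w) ^ n).re) := by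
  classical
  have hex : ∃ k, c k ≠ 0 := by
    by_contra! h
    exact hc0 (funext h)
  -- Since `r` decreases, the first nonzero coefficient belongs to the dominant exponential.
  obtain ⟨m, hm, hmin⟩ : ∃ m, c m ≠ 0 ∧ ∀ k < m, c k = 0 :=
    ⟨Nat.find hex, Nat.find_spec hex, fun k hk => not_not.1 (Nat.find_min hex hk)⟩
  have hw1 : ‖w‖ = 1 := by
    have : ‖w‖ ^ 4 = 1 := by rw [← norm_pow, hw, norm_I]
    exact (pow_eq_one_iff_of_nonneg (norm_nonneg _) (by norm_num)).1 this
  obtain ⟨j, hj⟩ := exists_re_mul_I_pow_pos hm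
  set δ := (c m * I ^ j).re with hδ
  set A := ∑' k, ‖c k‖ with hA
  have hpos (k) : 0 < r k := by linarith [hr1 k]
  -- On these exponents `w ^ n = I ^ j`, because `w ^ 16 = 1`; the later terms are at most `A * r (m
  -- + 1) ^ n`.
  have key (i : ℕ) : δ * r m ^ (4 * j + 16 * i) - A * r (m + 1) ^ (4 * j + 16 * i) ≤
      (∑' k, c k * ((r k : ℂ) * w) ^ (4 * j + 16 * i)).re := by
    set n := 4 * j + 16 * i with hn
    have hwn : w ^ n = I ^ j := by
      rw [hn, pow_add, pow_mul, hw, show 16 * i = 4 * (4 * i) by ring, pow_mul, hw, pow_mul,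
        I_pow_four, one_pow, mul_one]
    have hbd (k) : ‖if k = m then 0 else c k * ((r k : ℂ) * w) ^ n‖ ≤
        ‖c k‖ * r (m + 1) ^ n := by
      split_ifs with hk
      · rw [norm_zero]
        have := hpos (m + 1)
        positivity
      · rcases lt_or_gt_of_ne hk with hk | hk
        · simp [hmin k hk]
        · rw [norm_mul, norm_pow, norm_mul, hw1, mul_one, norm_real, Real.norm_eq_abs,
            abs_of_pos (hpos k)]
          gcongr
          · exact (hpos k).le
          · exact hr.antitone hk
    have hs : Summable fun k => c k * ((r k : ℂ) * w) ^ n := by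
      refine Summable.of_norm_bounded (hc.mul_right (r 0 ^ n)) fun k => ?_
      rw [norm_mul, norm_pow, norm_mul, hw1, mul_one, norm_real, Real.norm_eq_abs,
        abs_of_pos (hpos k)]
      gcongr
      · exact (hpos k).le
      · exact hr.antitone k.zero_le
    rw [hs.tsum_eq_add_tsum_ite m, add_re, mul_pow, hwn]
    have h1 : (c m * ((r m : ℂ) ^ n * I ^ j)).re = δ * r m ^ n := by
      rw [mul_left_comm, ← ofReal_pow, re_ofReal_mul, hδ, mul_comm]
    have h2 : ‖∑' k, if k = m then 0 else c k * ((r k : ℂ) * w) ^ n‖ ≤ A * r (m + 1) ^ n :=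
      tsum_of_norm_bounded (hc.hasSum.mul_right _) hbd
    have h3 := (abs_le.1 (abs_re_le_norm (∑' k, if k = m then 0 else
      c k * ((r k : ℂ) * w) ^ n))).1
    linarith
  rintro ⟨M, hM⟩
  have hq0 : 0 ≤ r (m + 1) / r m := (div_pos (hpos _) (hpos _)).le
  have hq1 : r (m + 1) / r m < 1 := (div_lt_one (hpos _)).2 (hr m.lt_succ_self)
  have hn : Filter.Tendsto (fun i : ℕ => 4 * j + 16 * i) Filter.atTop Filter.atTop :=
    Filter.tendsto_atTop_mono (fun i => show i ≤ 4 * j + 16 * i by omega) Filter.tendsto_id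
  have ht : Filter.Tendsto
      (fun n : ℕ => r m ^ n * (δ - A * (r (m + 1) / r m) ^ n)) Filter.atTop Filter.atTop := by
    refine (tendsto_pow_atTop_atTop_of_one_lt (hr1 m)).atTop_mul_pos hj ?_
    simpa using ((tendsto_pow_atTop_nhds_zero_of_lt_one hq0 hq1).const_mul A).const_sub δ
  obtain ⟨i, hi⟩ := ((ht.comp hn).eventually_gt_atTop M).exists
  have h1 := hM ⟨4 * j + 16 * i, rfl⟩
  have h2 := key i
  have h3 := (hpos m).ne'
  simp only [Function.comp_apply] at hi h1
  rw [div_pow, mul_sub, mul_left_comm, mul_div_cancel₀ _ (pow_ne_zero _ h3)] at hi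
  linarith

/-- An operator is convex-cyclic if it has a total sequence of eigenvectors whose eigenvalues lie
on the ray through an eighth root of `-1`, outside the unit disc. -/
lemma isConvexCyclic_of_eigenvectors [CompleteSpace X] {T : X →L[ℂ] X} {w : ℂ} (hw : w ^ 4 = I)
    {r : ℕ → ℝ} (hr : StrictAnti r) (hr1 : ∀ k, 1 < r k) {v : ℕ → X}
    (hv : ∀ k, T (v k) = ((r k : ℂ) * w) • v k)
    (htot : ∀ f : X →L[ℂ] ℂ, (∀ k, f (v k) = 0) → f = 0) : IsConvexCyclic T := by
  -- Positive weights making the series absolutely convergent; the `1 +` allows `v k = 0`.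
  let a : ℕ → ℝ := fun k => (1 / 2) ^ k / (1 + ‖v k‖)
  have ha (k) : 0 < a k := by positivity
  have hsn : Summable fun k => ‖(a k : ℂ) • v k‖ := by
    refine Summable.of_nonneg_of_le (fun _ => norm_nonneg _) (fun k => ?_) summable_geometric_two
    rw [norm_smul, norm_real, Real.norm_eq_abs, abs_of_pos (ha k), div_mul_eq_mul_div,
      div_le_iff₀ (by positivity)]
    gcongr
    linarith
  have hs := hsn.of_norm
  have hpow (n k) : (T ^ n) (v k) = ((r k : ℂ) * w) ^ n • v k := by
    induction n with
    | zero => simp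
    | succ n ih => rw [pow_succ', mul_apply_eq_comp, ih, map_smul, hv, smul_smul,
        pow_succ]
  refine ⟨∑' k, (a k : ℂ) • v k, 
    dense_convexHull_of_not_bddAbove (Set.range_nonempty _) fun f hf => ?_⟩
  have hfT (n : ℕ) : f ((T ^ n) (∑' k, (a k : ℂ) • v k)) =
      ∑' k, ((a k : ℂ) * f (v k)) * ((r k : ℂ) * w) ^ n := by
    rw [(T ^ n).map_tsum hs, f.map_tsum ((T ^ n).summable hs)]
    refine tsum_congr fun k => ?_
    rw [map_smul, hpow, map_smul, map_smul, smul_eq_mul, smul_eq_mul]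
    ring
  rw [← Set.range_comp]
  simp only [Function.comp_def, hfT]
  refine not_bddAbove_re_tsum hw hr hr1 ?_ fun h => hf (htot f fun k => ?_)
  · refine Summable.of_nonneg_of_le (fun _ => norm_nonneg _) (fun k => ?_) (hsn.mul_left ‖f‖)
    rw [← smul_eq_mul, ← map_smul]
    exact f.le_opNorm _
  · have := congrFun h k
    simpa [(ha k).ne'] using this

end ConvexCyclic

/-! ### Bang's lemma and growth of orbits -/

section Plank

variable {X : Type*} [NormedAddCommGroup X] [InnerProductSpace ℂ X]

/-- Bang's lemma for sequences: if the norms of a sequence tend to infinity fast enough, then some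
functional is at least `1` in modulus on the whole sequence. -/
lemma exists_one_le_norm_inner [CompleteSpace X] {v : ℕ → X} (hv0 : ∀ n, v n ≠ 0)
    (hv : Summable fun n => ‖v n‖⁻¹) : ∃ h : X, ∀ n, 1 ≤ ‖⟪h, v n⟫_ℂ‖ := by
  let σ : Bool → ℂ := fun b => if b then 1 else -1
  let t : ℕ → X := fun n => (((‖v n‖ ^ 2)⁻¹ : ℝ) : ℂ) • v n
  have hσ (b) : ‖σ b‖ = 1 := by cases b <;> simp [σ]
  have hpos (n) : 0 < ‖v n‖ := norm_pos_iff.2 (hv0 n)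
  have ht (n) : ‖t n‖ = ‖v n‖⁻¹ := by
    have := (hpos n).ne'
    rw [norm_smul, norm_real, Real.norm_eq_abs, abs_of_pos (by positivity)]
    field_simp
  have hbd (n) (ε : ℕ → Bool) : ‖σ (ε n) • t n‖ ≤ ‖v n‖⁻¹ := by
    rw [norm_smul, hσ, one_mul, ht]
  let g : (ℕ → Bool) → X := fun ε => ∑' n, σ (ε n) • t n
  have hsum (ε : ℕ → Bool) : Summable fun n => σ (ε n) • t n :=
    Summable.of_norm_bounded hv fun n => hbd n ε
  have hg : Continuous g := by
    refine continuous_tsum (fun n => ?_) hv hbd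
    exact ((continuous_of_discreteTopology (f := σ)).comp (continuous_apply n)).smul
      continuous_const
  -- Choose signs maximizing the norm of `∑ ± v n / ‖v n‖ ^ 2`, by compactness of the Cantor space.
  -- Flipping the `n`-th sign cannot increase the norm, which forces `‖t n‖ ^ 2 ≤ Re (σ (ε n) * ⟪g
  -- ε, t n⟫)`.
  obtain ⟨ε, -, hε⟩ := isCompact_univ.exists_isMaxOn Set.univ_nonempty hg.norm.continuousOn
  refine ⟨g ε, fun n => ?_⟩
  have hflip : g (Function.update ε n (!ε n)) = g ε - (2 * σ (ε n)) • t n := by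
    have h := (hsum ε).hasSum.update n (σ (!ε n) • t n)
    have hfun : Function.update (fun k => σ (ε k) • t k) n (σ (!ε n) • t n) =
        fun k => σ (Function.update ε n (!ε n) k) • t k := by
      funext k
      by_cases hk : k = n
      · subst hk; simp
      · simp [hk]
    rw [hfun] at h
    have h' := h.tsum_eq
    have hn : σ (!ε n) = - σ (ε n) := by cases ε n <;> simp [σ]
    change g (Function.update ε n (!ε n)) = _ at h'
    rw [h', hn]
    change _ + g ε = _
    module
  have hmax : ‖g ε - (2 * σ (ε n)) • t n‖ ^ 2 ≤ ‖g ε‖ ^ 2 := by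
    rw [← hflip]
    exact pow_le_pow_left₀ (norm_nonneg _) (hε (Set.mem_univ _)) 2
  rw [@norm_sub_sq ℂ, norm_smul, norm_mul, hσ, ht, inner_smul_right, inner_smul_right] at hmax
  have hre : RCLike.re (2 * σ (ε n) * ((((‖v n‖ ^ 2)⁻¹ : ℝ) : ℂ) * ⟪g ε, v n⟫_ℂ)) ≤
      2 * ((‖v n‖ ^ 2)⁻¹ * ‖⟪g ε, v n⟫_ℂ‖) := by
    refine (RCLike.re_le_norm _).trans_eq ?_
    rw [norm_mul, norm_mul, norm_mul, hσ, norm_real, Real.norm_eq_abs,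
      abs_of_pos (inv_pos.2 (pow_pos (hpos n) 2))]
    simp
  have h2 : ‖(2 : ℂ)‖ = 2 := by simp
  rw [h2] at hmax
  have hinv : 0 < (‖v n‖ ^ 2)⁻¹ := inv_pos.2 (pow_pos (hpos n) 2)
  have hsq : (‖v n‖⁻¹) ^ 2 = (‖v n‖ ^ 2)⁻¹ := inv_pow _ _
  have : (‖v n‖ ^ 2)⁻¹ * 1 ≤ (‖v n‖ ^ 2)⁻¹ * ‖⟪g ε, v n⟫_ℂ‖ := by
    rw [mul_one]
    rw [mul_one, mul_pow, hsq] at hmax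
    linarith
  exact le_of_mul_le_mul_left this hinv

/-- After expansion the difference of the two sides is `‖x‖ ^ 2 - ‖B x‖ ^ 2`. -/
lemma norm_sq_two_smul_add_ge {B : X →L[ℂ] X} (hB : ∀ x, ‖B x‖ ≤ ‖x‖) (x : X) :
    ‖x‖ ^ 2 + 2 * ‖(1 + B) x‖ ^ 2 ≤ ‖((2 : ℂ) • ContinuousLinearMap.id ℂ X + B) x‖ ^ 2 := by
  have h := pow_le_pow_left₀ (norm_nonneg _) (hB x) 2
  simp only [add_apply, smul_apply,
    ContinuousLinearMap.id_apply, one_apply_eq_self]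
  rw [@norm_add_sq ℂ, @norm_add_sq ℂ, norm_smul, inner_smul_left]
  simp
  linarith

/-- A lower bound for the growth of the orbits of `2 + B`, for a contraction `B`. -/
lemma norm_sq_pow_ge {B : X →L[ℂ] X} (hB : ∀ x, ‖B x‖ ≤ ‖x‖) (n k : ℕ) (x : X) :
    2 ^ k * (n.choose k : ℝ) * ‖((1 + B) ^ k) x‖ ^ 2 ≤
      ‖(((2 : ℂ) • ContinuousLinearMap.id ℂ X + B) ^ n) x‖ ^ 2 := by
  set T := (2 : ℂ) • ContinuousLinearMap.id ℂ X + B with hT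
  have hcomm : Commute (1 + B) T := by
    have h1 : T = 1 + (1 + B) := by
      ext y; simp [hT, two_smul, add_assoc]
    rw [h1]
    exact (Commute.one_right _).add_right (Commute.refl _)
  induction n generalizing k x with
  | zero =>
    cases k <;> simp
  | succ n ih =>
    have hstep := norm_sq_two_smul_add_ge hB ((T ^ n) x)
    rw [← hT, ← mul_apply_eq_comp, ← mul_apply_eq_comp, ← pow_succ',
      (hcomm.pow_right n).eq, mul_apply_eq_comp] at hstep
    cases k with
    | zero =>
      have := ih 0 x
      simp only [Nat.choose_zero_right] at this ⊢
      linarith [sq_nonneg ‖(T ^ n) ((1 + B) x)‖]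
    | succ k =>
      have h1 := ih (k + 1) x
      have h2 := ih k ((1 + B) x)
      rw [← mul_apply_eq_comp, ← pow_succ] at h2
      -- Pascal's rule matches the two terms of the one-step inequality.
      rw [Nat.choose_succ_succ, Nat.cast_add]
      calc _ = 2 ^ (k + 1) * (n.choose (k + 1) : ℝ) * ‖((1 + B) ^ (k + 1)) x‖ ^ 2 +
            2 * (2 ^ k * (n.choose k : ℝ) * ‖((1 + B) ^ (k + 1)) x‖ ^ 2) := by ring
        _ ≤ _ := by linarith

/-- The growth bound with `k = 4` gives a multiple of `n ^ 2`, so a convergent p-series dominates.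
-/
lemma summable_inv_norm_pow {B : X →L[ℂ] X} (hB : ∀ x, ‖B x‖ ≤ ‖x‖)
    (hinj : Function.Injective (1 + B : X →L[ℂ] X)) {x : X} (hx : x ≠ 0) :
    Summable fun n : ℕ => ‖(((2 : ℂ) • ContinuousLinearMap.id ℂ X + B) ^ n) x‖⁻¹ := by
  have hpos : 0 < ‖((1 + B : X →L[ℂ] X) ^ 4) x‖ := by
    refine norm_pos_iff.2 fun h => hx ?_
    have : Function.Injective ((1 + B) ^ 4 : X →L[ℂ] X) := by
      have h4 := hinj.iterate 4
      exact h4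
    exact this (h.trans (map_zero _).symm)
  set c := ‖((1 + B : X →L[ℂ] X) ^ 4) x‖
  rw [← summable_nat_add_iff 4]
  have hs : Summable fun n : ℕ => 2 / c * (1 / ((n + 1 : ℕ) : ℝ) ^ 2) :=
    ((summable_nat_add_iff 1).2 (Real.summable_one_div_nat_pow.2 one_lt_two)).mul_left _
  refine Summable.of_nonneg_of_le (fun _ => inv_nonneg.2 (norm_nonneg _)) (fun n => ?_) hs
  have h1 := norm_sq_pow_ge hB (n + 4) 4 x
  have h2 : ((n + 1 : ℕ) : ℝ) ^ 4 ≤ 24 * ((n + 4).choose 4 : ℝ) := by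
    have := Nat.pow_le_choose (α := ℝ) 4 (n + 4)
    rw [div_le_iff₀ (by positivity)] at this
    simpa [Nat.factorial, mul_comm] using this
  -- The factor `c / 2` suffices because `2 ^ 4 / 24 ≥ 1 / 4`.
  have h3 : c / 2 * ((n + 1 : ℕ) : ℝ) ^ 2 ≤
      ‖(((2 : ℂ) • ContinuousLinearMap.id ℂ X + B) ^ (n + 4)) x‖ := by
    refine le_of_sq_le_sq ?_ (norm_nonneg _)
    refine le_trans ?_ h1
    have := mul_le_mul_of_nonneg_right h2 (sq_nonneg c)
    nlinarith [sq_nonneg c]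
  have h4 : 0 < c / 2 * ((n + 1 : ℕ) : ℝ) ^ 2 := by positivity
  refine (inv_anti₀ h4 h3).trans_eq ?_
  field_simp

lemma not_isOneWeaklyHypercyclic_two_add [CompleteSpace X] [Nontrivial X] {B : X →L[ℂ] X}
    (hB : ∀ x, ‖B x‖ ≤ ‖x‖) (hinj : Function.Injective (1 + B : X →L[ℂ] X)) :
    ¬ IsOneWeaklyHypercyclic ((2 : ℂ) • ContinuousLinearMap.id ℂ X + B) := by
  rintro ⟨x, hx⟩
  set T := (2 : ℂ) • ContinuousLinearMap.id ℂ X + B with hT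
  by_cases hx0 : x = 0
  · obtain ⟨y, hy⟩ := exists_ne (0 : X)
    have hd := hx (innerSL ℂ y) fun h => hy (by
      simpa using congrArg (fun f : X →L[ℂ] ℂ => f y) h)
    obtain ⟨_, ⟨_, ⟨n, rfl⟩, rfl⟩, hn⟩ := hd.exists_mem_open Metric.isOpen_ball
      (Metric.nonempty_ball.2 one_pos : (Metric.ball (1 : ℂ) 1).Nonempty)
    simp [hx0] at hn
  · have hne (n : ℕ) : (T ^ n) x ≠ 0 := by
      have := norm_sq_pow_ge hB n 0 x
      intro h
      rw [← hT, h] at this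
      simp [hx0] at this
    obtain ⟨h, hh⟩ := exists_one_le_norm_inner hne (summable_inv_norm_pow hB hinj hx0)
    have hd := hx (innerSL ℂ h) fun h0 => by
      have := hh 0
      have h1 : ⟪h, (T ^ 0) x⟫_ℂ = 0 := congrArg (fun f : X →L[ℂ] ℂ => f ((T ^ 0) x)) h0
      rw [h1] at this
      norm_num at this
    obtain ⟨_, ⟨_, ⟨n, rfl⟩, rfl⟩, hn⟩ := hd.exists_mem_open Metric.isOpen_ball
      (Metric.nonempty_ball.2 one_pos : (Metric.ball (0 : ℂ) 1).Nonempty)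
    rw [mem_ball_zero_iff] at hn
    exact absurd (hh n) (not_le.2 hn)

end Plank

/-! ### The adjoint, and eigenvectors of the backward shift -/

namespace HardySpace

lemma ext_taylor {f g : HardySpace} (h : ∀ n, taylor f n = taylor g n) : f = g :=
  taylorₗ.injective (lp.ext (funext h))

lemma taylor_add (f g : HardySpace) (n : ℕ) : taylor (f + g) n = taylor f n + taylor g n := by
  have : taylor (f + g) = taylor f + taylor g := map_add taylorₗ f g
  rw [this]; rfl

lemma taylor_smul (c : ℂ) (f : HardySpace) (n : ℕ) : taylor (c • f) n = c * taylor f n := by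
  have : taylor (c • f) = c • taylor f := map_smul taylorₗ c f
  rw [this]; rfl

lemma norm_backwardShift_le (f : HardySpace) : ‖backwardShift f‖ ≤ ‖f‖ := by
  change ‖taylorₗᵢ.symm (tailOp (taylorₗᵢ f))‖ ≤ ‖f‖
  rw [LinearIsometryEquiv.norm_map, ← LinearIsometryEquiv.norm_map taylorₗᵢ f]
  refine (tailOp.le_opNorm _).trans (mul_le_of_le_one_left (norm_nonneg _) ?_)
  exact LinearMap.mkContinuous_norm_le _ zero_le_one _

/-- A kernel element has coefficients of constant modulus, so square-summability makes them zero. -/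
lemma injective_one_add_backwardShift : 
    Function.Injective (1 + backwardShift : HardySpace →L[ℂ] HardySpace) := by
  rw [injective_iff_map_eq_zero]
  intro f hf
  have hstep (n : ℕ) : ‖taylor f (n + 1)‖ = ‖taylor f n‖ := by
    have h : taylor (f + backwardShift f) n = 0 := by
      have h0 : f + backwardShift f = 0 := hf
      rw [h0]
      have : taylor 0 = 0 := map_zero taylorₗ
      rw [this]; rfl
    rw [taylor_add, taylor_backwardShift] at h
    rw [eq_neg_of_add_eq_zero_right h, norm_neg]
  have hconst (n : ℕ) : ‖taylor f n‖ = ‖taylor f 0‖ := by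
    induction n with
    | zero => rfl
    | succ n ih => rw [hstep, ih]
  have hs := ((memℓp_gen_iff (by norm_num)).1 (lp.memℓp (taylor f)))
  simp only [hconst] at hs
  have h0 := (summable_const_iff _).1 hs
  have h1 : ‖taylor f 0‖ = 0 := by simpa using h0
  refine ext_taylor fun n => ?_
  have : taylor 0 = 0 := map_zero taylorₗ
  rw [this]
  exact norm_eq_zero.1 ((hconst n).trans h1)

/-- The forward shift `(a₀, a₁, …) ↦ (0, a₀, a₁, …)` of a square-summable sequence. -/
noncomputable def consZero (a : lp (fun _ : ℕ => ℂ) 2) : lp (fun _ : ℕ => ℂ) 2 :=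
  ⟨_, memℓp_cons a⟩

lemma consZero_zero (a : lp (fun _ : ℕ => ℂ) 2) : consZero a 0 = 0 := rfl

lemma consZero_succ (a : lp (fun _ : ℕ => ℂ) 2) (n : ℕ) : consZero a (n + 1) = a n := rfl

lemma taylor_mulOp_two_add (f : HardySpace) :
    taylor (mulOp (fun z => 2 + (z : ℂ)) isMultiplier_two_add f) =
      (2 : ℂ) • taylor f + consZero (taylor f) := by
  refine taylor_eq fun z => ?_
  have h1 : toFunₗ (mulOp (fun z => 2 + (z : ℂ)) isMultiplier_two_add f) z =
      2 * toFunₗ f z + z * toFunₗ f z :=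
    (mulOp_apply _ isMultiplier_two_add f z).trans (add_mul _ _ _)
  have h2 : HasSum (fun n : ℕ => consZero (taylor f) n * (z : ℂ) ^ n) (z * toFunₗ f z) := by
    rw [← hasSum_nat_add_iff' 1]
    simpa [consZero_zero, consZero_succ, pow_succ', mul_left_comm] using
      (hasSum_taylor f z).mul_left (z : ℂ)
  rw [h1]
  refine (((hasSum_taylor f z).mul_left 2).add h2).congr_fun fun n => ?_
  rw [← mul_assoc, ← add_mul]
  rfl

lemma adjoint_mulOp_two_add :
    ContinuousLinearMap.adjoint (mulOp (fun z => 2 + (z : ℂ)) isMultiplier_two_add) =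
      (2 : ℂ) • ContinuousLinearMap.id ℂ HardySpace + backwardShift := by
  symm
  rw [ContinuousLinearMap.eq_adjoint_iff]
  intro f g
  have h1 : ⟪taylor (backwardShift f), taylor g⟫_ℂ =
      ⟪taylor f, consZero (taylor g)⟫_ℂ := by
    have hl := lp.hasSum_inner (𝕜 := ℂ) (taylor (backwardShift f)) (taylor g)
    have h := (hasSum_nat_add_iff' 1).2 (lp.hasSum_inner (𝕜 := ℂ) (taylor f) (consZero (taylor g)))
    rw [Finset.sum_range_one, consZero_zero, inner_zero_right, sub_zero] at h
    simp only [taylor_backwardShift] at hl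
    exact hl.unique h
  have h2 : taylor (((2 : ℂ) • ContinuousLinearMap.id ℂ HardySpace + backwardShift) f) =
      (2 : ℂ) • taylor f + taylor (backwardShift f) :=
    (map_add taylorₗ ((2 : ℂ) • f) (backwardShift f)).trans
      (congrArg (· + taylor (backwardShift f)) (map_smul taylorₗ (2 : ℂ) f))
  rw [inner_eq, inner_eq, taylor_mulOp_two_add, h2, inner_add_left, inner_add_right,
    inner_smul_left, inner_smul_right, h1, map_ofNat]

/-- The sequence `(1, a, a², …)` as an element of the Hardy space, for `a` in the disc. -/
noncomputable def geometric (a : 𝔻) : HardySpace :=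
  taylorₗᵢ.symm ⟨fun n => (a : ℂ) ^ n, by
    refine (memℓp_gen_iff (by norm_num)).2 ?_
    have h : ‖(a : ℂ)‖ ^ 2 < 1 := by
      have := a.norm_lt_one
      have := norm_nonneg (a : ℂ)
      nlinarith
    refine (summable_geometric_of_lt_one (sq_nonneg _) h).congr fun n => ?_
    rw [norm_pow, ← pow_mul, mul_comm, pow_mul]
    simp⟩

lemma taylor_geometric (a : 𝔻) (n : ℕ) : taylor (geometric a) n = (a : ℂ) ^ n :=
  congrArg (fun a : lp (fun _ : ℕ => ℂ) 2 => a n) (taylorₗᵢ.apply_symm_apply _)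

lemma two_add_backwardShift_geometric (a : 𝔻) :
    ((2 : ℂ) • ContinuousLinearMap.id ℂ HardySpace + backwardShift) (geometric a) =
      (2 + (a : ℂ)) • geometric a := by
  refine ext_taylor fun n => ?_
  change taylor ((2 : ℂ) • geometric a + backwardShift (geometric a)) n = _
  rw [taylor_add, taylor_smul, taylor_backwardShift, taylor_smul, taylor_geometric,
    taylor_geometric]
  ring

/-- A functional on the Hardy space is a power series on the geometric sequences. -/
lemma hasSum_apply_geometric (g : HardySpace) (a : 𝔻) :
    HasSum (fun n : ℕ => (starRingEnd ℂ) (taylor g n) * (a : ℂ) ^ n) ⟪g, geometric a⟫_ℂ := by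
  rw [inner_eq]
  refine (lp.hasSum_inner (𝕜 := ℂ) (taylor g) (taylor (geometric a))).congr_fun fun n => ?_
  rw [taylor_geometric, RCLike.inner_apply, mul_comm]

/-- The geometric sequences with ratios that accumulate in the disc are total. -/
lemma eq_zero_of_apply_geometric_eq_zero {u : ℕ → 𝔻} {a : 𝔻} (hua : ∀ k, u k ≠ a)
    (hu : Filter.Tendsto (fun k => (u k : ℂ)) Filter.atTop (nhds (a : ℂ)))
    {f : HardySpace →L[ℂ] ℂ} (hf : ∀ k, f (geometric (u k)) = 0) : f = 0 := by
  obtain ⟨g, rfl⟩ := (InnerProductSpace.toDual ℂ HardySpace).surjective f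
  let b : ℕ → ℂ := fun n => (starRingEnd ℂ) (taylor g n)
  let F : ℂ → ℂ := fun z => ∑' n, b n * z ^ n
  have hF (z : 𝔻) : HasSum (fun n => b n * (z : ℂ) ^ n) (F z) :=
    (hasSum_apply_geometric g z).summable.hasSum
  have hFg (z : 𝔻) : F z = ⟪g, geometric z⟫_ℂ := (hasSum_apply_geometric g z).tsum_eq
  have hp : HasFPowerSeriesOnBall F (FormalMultilinearSeries.ofScalars ℂ b) 0 1 := by
    refine ⟨?_, one_pos, fun {z} hz => ?_⟩
    · refine FormalMultilinearSeries.le_radius_of_bound (r := 1) _ ‖taylor g‖ fun n => ?_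
      rw [FormalMultilinearSeries.ofScalars_norm]
      simpa [b] using lp.norm_apply_le_norm (by norm_num) (taylor g) n
    · have hz' : ‖z‖ < 1 := by
        rwa [← ENNReal.ofReal_one, Metric.eball_ofReal, mem_ball_zero_iff] at hz
      have := hF (UnitDisc.mk z hz')
      simpa [FormalMultilinearSeries.ofScalars_apply_eq, mul_comm] using this
  have han : AnalyticOnNhd ℂ F (Metric.ball 0 1) := by
    have := hp.analyticOnNhd
    rwa [← ENNReal.ofReal_one, Metric.eball_ofReal] at this
  -- Identity theorem: the zeros `u k` accumulate at `a`, inside the disc.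
  have hzero : Set.EqOn F 0 (Metric.ball 0 1) := by
    refine han.eqOn_zero_of_preconnected_of_frequently_eq_zero
      (convex_ball _ _).isPreconnected (by simpa using a.norm_lt_one) ?_
    refine Filter.Tendsto.frequently (l₁ := Filter.atTop) (f := fun k => (u k : ℂ)) ?_
      (Filter.Frequently.of_forall fun k => ?_)
    · exact tendsto_nhdsWithin_iff.2 ⟨hu, Filter.Eventually.of_forall fun k h =>
        hua k (UnitDisc.coe_injective h)⟩
    · rw [hFg]
      exact hf k
  have hb : b = 0 := coeff_eq_zero fun z => by
    have := hF z
    rwa [hzero (by simpa using z.norm_lt_one)] at this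
  have hg : g = 0 := ext_taylor fun n => by
    have h0 : taylor 0 = 0 := map_zero taylorₗ
    rw [h0]
    exact (map_eq_zero _).1 (congrFun hb n)
  rw [hg, map_zero]

/-- Places a segment of the ray at angle `π / 8` among the eigenvalues `2 + a`. As `cos (π / 8) > 9
/ 10`, it is enough that `r ^ 2 - 3.6 * r + 3 < 0` on `[2, 2.1]`. -/
lemma norm_mul_exp_pi_div_eight_sub_two_lt {r : ℝ} (h2 : 2 ≤ r) (hr : r ≤ 2 + 1 / 10) :
    ‖(r : ℂ) * exp ((Real.pi / 8 : ℝ) * I) - 2‖ < 1 := by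
  have hc : 9 / 10 < Real.cos (Real.pi / 8) := by
    rw [Real.cos_pi_div_eight]
    have h1 : 1.4 < √2 := Real.lt_sqrt_of_sq_lt (by norm_num)
    have h3 : 1.8 < √(2 + √2) := Real.lt_sqrt_of_sq_lt (by norm_num at h1 ⊢; linarith)
    norm_num at h3 ⊢
    linarith
  have hsc := Real.sin_sq_add_cos_sq (Real.pi / 8)
  rw [← sq_lt_one_iff₀ (norm_nonneg _), ← normSq_eq_norm_sq, exp_mul_I, ← ofReal_cos,
    ← ofReal_sin, normSq_apply]
  generalize Real.cos (Real.pi / 8) = c at *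
  generalize Real.sin (Real.pi / 8) = d at *
  simp
  have h3 : r * (9 / 10) ≤ r * c := by gcongr
  calc (r * c - 2) * (r * c - 2) + r * d * (r * d) = r ^ 2 * (d ^ 2 + c ^ 2) - 4 * (r * c) + 4 := by
        ring
    _ < 1 := by
      rw [hsc]
      nlinarith

lemma isConvexCyclic_two_add_backwardShift :
    IsConvexCyclic ((2 : ℂ) • ContinuousLinearMap.id ℂ HardySpace + backwardShift) := by
  set w : ℂ := exp ((Real.pi / 8 : ℝ) * I) with hw
  have hw4 : w ^ 4 = I := by
    rw [hw, ← exp_nat_mul]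
    convert exp_pi_div_two_mul_I using 2
    push_cast
    ring
  have hw0 : w ≠ 0 := exp_ne_zero _
  -- The shift by `10` keeps `r k` in `[2, 2.1]`; the limit `2` still gives a point `a` of the disc.
  let r : ℕ → ℝ := fun k => 2 + 1 / ((k : ℝ) + 10)
  have hr2 (k) : 2 < r k := lt_add_of_pos_right _ (by positivity)
  have hr (k) : r k ≤ 2 + 1 / 10 := by
    have : (0 : ℝ) ≤ k := k.cast_nonneg
    simp only [r]
    gcongr
    linarith
  let u : ℕ → 𝔻 := fun k =>
    UnitDisc.mk (r k * w - 2) (norm_mul_exp_pi_div_eight_sub_two_lt (hr2 k).le (hr k))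
  let a : 𝔻 := UnitDisc.mk ((2 : ℝ) * w - 2)
    (norm_mul_exp_pi_div_eight_sub_two_lt le_rfl (by norm_num))
  refine isConvexCyclic_of_eigenvectors hw4 (r := r) (v := fun k => geometric (u k)) ?_
    (fun k => by linarith [hr2 k]) (fun k => ?_) fun f hf =>
      eq_zero_of_apply_geometric_eq_zero (u := u) (a := a) (fun k h => ?_) ?_ hf
  · intro k l hkl
    have : (k : ℝ) < l := by exact_mod_cast hkl
    simp only [r]
    gcongr
  · rw [two_add_backwardShift_geometric]
    congr 1
    simp [u]
  · have h1 : (r k : ℂ) * w - 2 = (2 : ℝ) * w - 2 := congrArg (fun z : 𝔻 => (z : ℂ)) h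
    have h2 := mul_right_cancel₀ hw0 (sub_left_inj.1 h1)
    exact (hr2 k).ne' (ofReal_injective h2)
  · have h1 : Filter.Tendsto r Filter.atTop (nhds 2) := by
      have : Filter.Tendsto (fun k : ℕ => 1 / ((k : ℝ) + 10)) Filter.atTop (nhds 0) :=
        tendsto_const_nhds.div_atTop
          (Filter.tendsto_atTop_add_const_right _ _ tendsto_natCast_atTop_atTop)
      simpa [r] using this.const_add 2
    exact (((continuous_ofReal.tendsto 2).comp h1).mul_const w).sub_const 2

instance : Nontrivial HardySpace := by
  refine ⟨geometric 0, 0, fun h => ?_⟩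
  have h1 := taylor_geometric 0 0
  have h0 : taylor 0 = 0 := map_zero taylorₗ
  rw [h, h0] at h1
  simp at h1

end HardySpace

theorem mainTheorem12 :
    ContinuousLinearMap.adjoint
        (HardySpace.mulOp (fun z => 2 + (z : ℂ)) HardySpace.isMultiplier_two_add) =
      (2 : ℂ) • ContinuousLinearMap.id ℂ HardySpace + HardySpace.backwardShift ∧
    IsConvexCyclic (ContinuousLinearMap.adjoint
        (HardySpace.mulOp (fun z => 2 + (z : ℂ)) HardySpace.isMultiplier_two_add)) ∧
    ¬ IsOneWeaklyHypercyclic (ContinuousLinearMap.adjoint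
        (HardySpace.mulOp (fun z => 2 + (z : ℂ)) HardySpace.isMultiplier_two_add)) := by
  rw [HardySpace.adjoint_mulOp_two_add]
  exact ⟨rfl, HardySpace.isConvexCyclic_two_add_backwardShift,
    not_isOneWeaklyHypercyclic_two_add HardySpace.norm_backwardShift_le
      HardySpace.injective_one_add_backwardShift⟩
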